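/- Let $d\ge 1$. A state on $\mathbb{C}^d$ is a positive semidefinite matrix of trace one; a POVM $\mathbf M=\{M_1,\dots,M_m\}$ is a family of positive semidefinite operators with $\sum_i M_i=\mathbf 1$, and it is a PVM if moreover $M_i^2=M_i$ for all $i$. For a PVM $\mathbf P$ put $\Delta_{\mathbf P}(\varrho)=\sum_i P_i\varrho P_i$ and $$R_c(\varrho,\mathbf P)=\min_{\{q_j,|\psi_j\rangle\}}\sum_j q_j\,S\big(\Delta_{\mathbf P}(|\psi_j\rangle\langle\psi_j|)\big),\qquad R_q(\varrho,\mathbf P)=S\big(\varrho\,\|\,\Delta_{\mathbf P}(\varrho)\big),$$ where the minimum is over finite pure-state decompositions $\varrho=\sum_j q_j|\psi_j\rangle\langle\psi_j|$, $S(\varrho)=-\operatorname{tr}(\varrho\log\varrho)$ is the von Neumann entropy and $S(\varrho\|\tau)=\operatorname{tr}(\varrho\log\varrho-\varrho\log\tau)$ the quantum relative entropy (logarithms to base two). For $R\in\{R_c,R_q\}$ the intrinsic randomness of a state $\rho$ under a POVM $\mathbf M$ is $$R(\rho,\mathbf M)=\inf_{\mathbf P,\sigma}R(\rho\otimes\sigma,\mathbf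 P),$$ over all generalized Naimark extensions, that is, states $\sigma$ on a finite-dimensional ancilla $Q$ and PVMs $\mathbf P$ on $\mathbb{C}^d\otimes Q$ with $M_i=\operatorname{tr}_Q[P_i(\mathbf 1\otimes\sigma)]$ for all $i$. The convex-roof version is $R^{cf}(\rho,\mathbf M)=\inf\sum_j r_jR(\rho,\mathbf N^j)$ over all finite convex decompositions $\mathbf M=\sum_j r_j\mathbf N^j$ into extremal POVMs. A state $\rho$ is non-random if its intrinsic randomness is $0$. A SIC measurement on $\mathbb{C}^d$ is a POVM with elements $M_i=\frac1d|\phi_i\rangle\langle\phi_i|$, $i=1,\dots,d^2$, where the $\phi_i$ are unit vectors with $|\langle\phi_j|\phi_i\rangle|^2=\frac1{d+1}$ for $i\ne j$. Observation. Some POVMs, such as SIC measurements, have no non-random states. Precisely, let $d\ge2$ and let $\mathbf M$ be any SIC measurement on $\mathbb{C}^d$. Then every $M_i$ has exactly the eigenvalues $0$ and $1/d$, so none of them has an eigenvector with eigenvalue $1$; and every state $\rho$ on $\mathbb{C}^d$ satisfies $R(\rho,\mathbf M)>0$ and $R^{cf}(\rho,\mathbf M)>0$, for both $R=R_c$ and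 $R=R_q$. Hence $\mathbf M$ has no non-random state with respect to any of these functions. Moreover SIC measurements exist, for instance on $\mathbb{C}^2$, so POVMs without non-random states do exist. -/

import Mathlib

open scoped Kronecker Matrix ComplexOrder

noncomputable section

namespace QRandomness

variable {ι κ o : Type*} [Fintype ι] [DecidableEq ι] [Fintype κ] [DecidableEq κ] [Fintype o]

/-- A state (density matrix) on `ℂ^ι`. -/
def IsState (ρ : Matrix ι ι ℂ) : Prop :=
  ρ.PosSemidef ∧ ρ.trace = 1

/-- A POVM on `ℂ^ι` with outcome set `o`. -/
def IsPOVM (M : o → Matrix ι ι ℂ) : Prop :=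
  (∀ i, (M i).PosSemidef) ∧ ∑ i, M i = 1

/-- A projection-valued measure: a POVM all of whose elements are projections. -/
def IsPVM (P : o → Matrix ι ι ℂ) : Prop :=
  IsPOVM P ∧ ∀ i, P i * P i = P i

/-- A normalized vector of `ℂ^ι`. -/
def IsUnitVec (ψ : ι → ℂ) : Prop :=
  star ψ ⬝ᵥ ψ = 1

/-- The rank-one operator `|ψ⟩⟨ψ|`. -/
def ketbra (ψ : ι → ℂ) : Matrix ι ι ℂ :=
  Matrix.vecMulVec ψ (star ψ)

/-- A symmetric informationally complete (SIC) measurement on `ℂ^d`: a POVM consisting of the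
`d ^ 2` operators `|φ i⟩⟨φ i| / d`, with normalized vectors satisfying
`|⟨φ j|φ i⟩| ^ 2 = 1 / (d + 1)` for `i ≠ j`. -/
def IsSIC {d : ℕ} (M : Fin (d ^ 2) → Matrix (Fin d) (Fin d) ℂ) : Prop :=
  IsPOVM M ∧ ∃ φ : Fin (d ^ 2) → Fin d → ℂ,
    (∀ i, IsUnitVec (φ i)) ∧
    (∀ i j, i ≠ j → ‖star (φ j) ⬝ᵥ φ i‖ ^ 2 = 1 / ((d : ℝ) + 1)) ∧
    ∀ i, M i = (1 / (d : ℂ)) • ketbra (φ i)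

/-- Base-two logarithm of a Hermitian matrix, by functional calculus. The eigenvalue `0` is sent
to `0`, which implements `0 log 0 = 0` below. -/
def matLog (ρ : Matrix ι ι ℂ) : Matrix ι ι ℂ :=
  cfc (Real.logb 2) ρ

/-- Von Neumann entropy `S(ρ) = -tr (ρ log ρ)`. -/
def vnEntropy (ρ : Matrix ι ι ℂ) : ℝ :=
  -(ρ * matLog ρ).trace.re

/-- Quantum relative entropy `S(ρ‖τ) = tr (ρ log ρ - ρ log τ)`, for states with
`ker τ ⊆ ker ρ`. It is only used for `τ = Δ_P(ρ)`, where this inclusion always holds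
(see `ker_dephase`). -/
def relEntropy (ρ τ : Matrix ι ι ℂ) : ℝ :=
  (ρ * matLog ρ - ρ * matLog τ).trace.re

/-- The block-dephasing operation `Δ_P(ρ) = ∑ i, P i ρ P i`. -/
def dephase (P : o → Matrix ι ι ℂ) (ρ : Matrix ι ι ℂ) : Matrix ι ι ℂ :=
  ∑ i, P i * ρ * P i

/-- The kernel of `Δ_P(ρ)` is contained in the kernel of `ρ`. -/
theorem ker_dephase (P : o → Matrix ι ι ℂ) (hP : IsPVM P) (ρ : Matrix ι ι ℂ)
    (hρ : IsState ρ) (v : ι → ℂ) (hv : dephase P ρ *ᵥ v = 0) : ρ *ᵥ v = 0 := by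
  have key : ∀ i, star (P i *ᵥ v) ⬝ᵥ (ρ *ᵥ (P i *ᵥ v)) = star v ⬝ᵥ ((P i * ρ * P i) *ᵥ v) := by
    intro i
    have h : (P i)ᴴ = P i := (hP.1.1 i).1
    rw [Matrix.star_mulVec, h, ← Matrix.dotProduct_mulVec, Matrix.mulVec_mulVec,
      Matrix.mulVec_mulVec, Matrix.mul_assoc]
  have hsum : ∑ i, star (P i *ᵥ v) ⬝ᵥ (ρ *ᵥ (P i *ᵥ v)) = 0 := by
    simp_rw [key]
    rw [← dotProduct_sum, ← Matrix.sum_mulVec]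
    change star v ⬝ᵥ (dephase P ρ *ᵥ v) = 0
    rw [hv, dotProduct_zero]
  have h0 : ∀ i, ρ *ᵥ (P i *ᵥ v) = 0 := by
    intro i
    have := (Finset.sum_eq_zero_iff_of_nonneg
      (fun i _ => hρ.1.dotProduct_mulVec_nonneg (P i *ᵥ v))).1 hsum i (Finset.mem_univ i)
    exact (hρ.1.dotProduct_mulVec_zero_iff _).1 this
  calc ρ *ᵥ v = ρ *ᵥ ((∑ i, P i) *ᵥ v) := by rw [hP.1.2, Matrix.one_mulVec]
    _ = 0 := by
      rw [Matrix.sum_mulVec, Matrix.mulVec_sum]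
      exact Finset.sum_eq_zero fun i _ => h0 i

/-- `R_c(ρ, P)`: the convex roof, i.e. the least average of `S(Δ_P(|ψ j⟩⟨ψ j|))` over the
finite pure-state decompositions `ρ = ∑ j, q j |ψ j⟩⟨ψ j|`. -/
def pvmRc (P : o → Matrix ι ι ℂ) (ρ : Matrix ι ι ℂ) : ℝ :=
  sInf {r : ℝ | ∃ (k : ℕ) (q : Fin k → ℝ) (ψ : Fin k → ι → ℂ),
    (∀ j, 0 ≤ q j) ∧ ∑ j, q j = 1 ∧ (∀ j, IsUnitVec (ψ j)) ∧
    ρ = ∑ j, (q j : ℂ) • ketbra (ψ j) ∧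
    r = ∑ j, q j * vnEntropy (dephase P (ketbra (ψ j)))}

/-- `R_q(ρ, P) = S(ρ‖Δ_P(ρ))`. -/
def pvmRq (P : o → Matrix ι ι ℂ) (ρ : Matrix ι ι ℂ) : ℝ :=
  relEntropy ρ (dephase P ρ)

/-- The two randomness functions for projection-valued measures. -/
inductive RandomnessKind : Type
  | c
  | q

/-- The randomness `R(ρ, P)` of measuring the state `ρ` with the PVM `P`. -/
def pvmRandomness (t : RandomnessKind) (P : o → Matrix ι ι ℂ) (ρ : Matrix ι ι ℂ) : ℝ :=
  match t with
  | .c => pvmRc P ρ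
  | .q => pvmRq P ρ

/-- Partial trace over the second tensor factor. -/
def traceQ (X : Matrix (ι × κ) (ι × κ) ℂ) : Matrix ι ι ℂ :=
  Matrix.of fun a b => ∑ s, X (a, s) (b, s)

/-- `{P, σ}` is a generalized Naimark extension of `M`: `P` is a PVM on `ℂ^ι ⊗ ℂ^κ`, the ancillary
state `σ` on `ℂ^κ` may be mixed, and `M i = tr_Q (P i (1 ⊗ σ))`. -/
def IsNaimarkExtension (M : o → Matrix ι ι ℂ) (P : o → Matrix (ι × κ) (ι × κ) ℂ)
    (σ : Matrix κ κ ℂ) : Prop :=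
  IsPVM P ∧ IsState σ ∧ ∀ i, M i = traceQ (P i * ((1 : Matrix ι ι ℂ) ⊗ₖ σ))

/-- The intrinsic randomness `R(ρ, M)`: the least value of `R(ρ ⊗ σ, P)` over all generalized
Naimark extensions `{P, σ}` of `M`, with ancillas of every finite dimension. -/
def intrinsicRandomness (t : RandomnessKind) (ρ : Matrix ι ι ℂ) (M : o → Matrix ι ι ℂ) : ℝ :=
  sInf {r : ℝ | ∃ (n : ℕ) (P : o → Matrix (ι × Fin n) (ι × Fin n) ℂ)
    (σ : Matrix (Fin n) (Fin n) ℂ),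
    IsNaimarkExtension M P σ ∧ r = pvmRandomness t P (ρ ⊗ₖ σ)}

/-- Extremal POVMs: extreme points of the convex set of POVMs. -/
def IsExtremalPOVM (M : o → Matrix ι ι ℂ) : Prop :=
  M ∈ Set.extremePoints ℝ {N : o → Matrix ι ι ℂ | IsPOVM N}

/-- The convex-roof intrinsic randomness `R^cf(ρ, M)`: the least average of `R(ρ, N j)` over all
finite decompositions `M = ∑ j, r j N j` into extremal POVMs. -/
def intrinsicRandomnessCf (t : RandomnessKind) (ρ : Matrix ι ι ℂ) (M : o → Matrix ι ι ℂ) : ℝ :=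
  sInf {x : ℝ | ∃ (k : ℕ) (r : Fin k → ℝ) (N : Fin k → o → Matrix ι ι ℂ),
    (∀ j, 0 ≤ r j) ∧ ∑ j, r j = 1 ∧ (∀ j, IsExtremalPOVM (N j)) ∧
    (∀ i, M i = ∑ j, (r j : ℂ) • N j i) ∧
    x = ∑ j, r j * intrinsicRandomness t ρ (N j)}

/-- Non-random states of a POVM `M`, with respect to the randomness function of kind `t`. -/
def IsNonRandom (t : RandomnessKind) (M : o → Matrix ι ι ℂ) (ρ : Matrix ι ι ℂ) : Prop :=
  IsState ρ ∧ intrinsicRandomness t ρ M = 0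

/-- Non-random states of a POVM `M`, with respect to the convex-roof intrinsic randomness. -/
def IsNonRandomCf (t : RandomnessKind) (M : o → Matrix ι ι ℂ) (ρ : Matrix ι ι ℂ) : Prop :=
  IsState ρ ∧ intrinsicRandomnessCf t ρ M = 0

end QRandomness

end

open scoped Kronecker Matrix ComplexOrder

namespace QRandomness

/-! ### Trace formulas for the functional calculus, and polynomial lower bounds on entropies. -/

section Spectral

variable {n : Type*} [Fintype n] [DecidableEq n]

/-! Every Naimark extension of a SIC measurement is rigid on the support of its ancilla state. Let
`E` be the support projection of `σ` and `G = 1 ⊗ E`. Since `M i` has rank one, `P i` kills the part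
of `G` orthogonal to `φ i`; linear independence of the SIC projections then forces `G * P i * G =
(1/d) |φ i⟩⟨φ i| ⊗ E` (`IsSICFrame.compression_eq`).

Consequently a Hermitian `A` supported under `G` with `tr A² = 1` satisfies `tr Δ_P(A)² ≤ 1/d`
(`IsSICFrame.re_trace_dephase_sq_le`). Taking `A = |ψ⟩⟨ψ|` handles `R_c`, through the linear-entropy
bound `vnEntropy_ge`; taking `A = √(ρ ⊗ σ)` handles `R_q`, through the affinity bound
`relEntropy_ge`. Both randomness functions are thus at least `(1 - 1/d) / ln 2`, whatever the
ancilla, so the infimum stays positive.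

The convex roof adds nothing: a SIC measurement is extremal, so all components of positive weight in
a decomposition coincide with it. -/

theorem trace_cfc {A : Matrix n n ℂ} (hA : A.IsHermitian) (f : ℝ → ℝ) :
    (cfc f A).trace = ((∑ i, f (hA.eigenvalues i) : ℝ) : ℂ) := by
  rw [hA.cfc_eq, Matrix.IsHermitian.cfc, Unitary.conjStarAlgAut_apply, Matrix.trace_mul_cycle,
    Unitary.coe_star_mul_self, one_mul, Matrix.trace_diagonal]
  simp

/-- The squared overlaps of the eigenbases of two Hermitian matrices. -/
noncomputable def eigenOverlap {A B : Matrix n n ℂ} (hA : A.IsHermitian) (hB : B.IsHermitian)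
    (i j : n) : ℝ :=
  Complex.normSq ((star (hA.eigenvectorUnitary : Matrix n n ℂ) *
    (hB.eigenvectorUnitary : Matrix n n ℂ)) i j)

theorem eigenOverlap_nonneg {A B : Matrix n n ℂ} (hA : A.IsHermitian) (hB : B.IsHermitian)
    (i j : n) : 0 ≤ eigenOverlap hA hB i j :=
  Complex.normSq_nonneg _

/-- The nonnegative weights do not depend on `f` and `g`, so scalar inequalities between pairs of
eigenvalues lift to trace inequalities for noncommuting matrices. -/
theorem trace_cfc_mul_cfc {A B : Matrix n n ℂ} (hA : A.IsHermitian) (hB : B.IsHermitian)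
    (f g : ℝ → ℝ) :
    (cfc f A * cfc g B).trace = ((∑ i, ∑ j, f (hA.eigenvalues i) * g (hB.eigenvalues j) *
      eigenOverlap hA hB i j : ℝ) : ℂ) := by
  set U := (hA.eigenvectorUnitary : Matrix n n ℂ) with hU
  set V := (hB.eigenvectorUnitary : Matrix n n ℂ) with hV
  set a : n → ℂ := fun i => (f (hA.eigenvalues i) : ℂ) with ha
  set b : n → ℂ := fun i => (g (hB.eigenvalues i) : ℂ) with hb
  have hfA : cfc f A = U * Matrix.diagonal a * star U := by
    rw [hA.cfc_eq, Matrix.IsHermitian.cfc, Unitary.conjStarAlgAut_apply]; rfl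
  have hgB : cfc g B = V * Matrix.diagonal b * star V := by
    rw [hB.cfc_eq, Matrix.IsHermitian.cfc, Unitary.conjStarAlgAut_apply]; rfl
  have h1 : (cfc f A * cfc g B).trace =
      (Matrix.diagonal a * (star U * V) * (Matrix.diagonal b * (star (star U * V)))).trace := by
    rw [hfA, hgB, Matrix.mul_assoc U, Matrix.mul_assoc U, Matrix.trace_mul_comm U]
    simp only [star_mul, star_star, Matrix.mul_assoc]
  rw [h1, Matrix.trace]
  push_cast
  refine Finset.sum_congr rfl fun i _ => ?_
  rw [Matrix.diag_apply, Matrix.mul_apply]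
  refine Finset.sum_congr rfl fun j _ => ?_
  rw [Matrix.diagonal_mul, Matrix.diagonal_mul, eigenOverlap, ← Complex.mul_conj,
    Matrix.star_apply]
  simp only [ha, hb, ← hU, ← hV]
  change _ * _ * (_ * (starRingEnd ℂ) _) = _
  ring

/-- Evaluate `⟨u i, A v j⟩` twice: it is zero because `v j` lies in the kernel of `B`, and it is the
`i`-th eigenvalue of `A` times `⟨u i, v j⟩`. -/
theorem eigenvalue_mul_eigenOverlap {A B : Matrix n n ℂ} (hA : A.IsHermitian)
    (hB : B.IsHermitian) (hker : ∀ v, B *ᵥ v = 0 → A *ᵥ v = 0) (i j : n)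
    (hj : hB.eigenvalues j = 0) : hA.eigenvalues i = 0 ∨ eigenOverlap hA hB i j = 0 := by
  set U := (hA.eigenvectorUnitary : Matrix n n ℂ) with hU
  set V := (hB.eigenvectorUnitary : Matrix n n ℂ) with hV
  have hv : A *ᵥ (fun a => V a j) = 0 := by
    apply hker
    have := hB.mulVec_eigenvectorBasis j
    rw [hj, zero_smul] at this
    exact this
  have hUA : star U * A = Matrix.diagonal (fun i => (hA.eigenvalues i : ℂ)) * star U := by
    have h2 : A = U * Matrix.diagonal (fun i => (hA.eigenvalues i : ℂ)) * star U := by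
      have := hA.spectral_theorem
      rw [Unitary.conjStarAlgAut_apply] at this
      exact this
    have h3 : star U * U = 1 := Unitary.coe_star_mul_self _
    conv_lhs => rw [h2]
    rw [← Matrix.mul_assoc, ← Matrix.mul_assoc, h3, Matrix.one_mul]
  have h4 : (star U * A * V) i j = 0 := by
    rw [Matrix.mul_assoc, Matrix.mul_apply]
    refine Finset.sum_eq_zero fun k _ => ?_
    have : (A * V) k j = (A *ᵥ (fun a => V a j)) k := rfl
    rw [this, hv]; simp
  rw [hUA, Matrix.mul_assoc, Matrix.diagonal_mul] at h4
  rcases mul_eq_zero.1 h4 with h | h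
  · left; exact_mod_cast h
  · right; rw [eigenOverlap, ← hU, ← hV, h, map_zero]

theorem cfc_id_of_isHermitian {A : Matrix n n ℂ} (hA : A.IsHermitian) :
    cfc (fun x : ℝ => x) A = A :=
  cfc_id' ℝ A hA

theorem cfc_mul_of_isHermitian {A : Matrix n n ℂ} (f g : ℝ → ℝ) :
    cfc f A * cfc g A = cfc (fun x => f x * g x) A :=
  (cfc_mul f g A (Matrix.finite_real_spectrum.continuousOn _)
    (Matrix.finite_real_spectrum.continuousOn _)).symm

theorem isHermitian_cfc (A : Matrix n n ℂ) (f : ℝ → ℝ) : (cfc f A).IsHermitian :=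
  cfc_predicate f A

theorem cfc_sqrt_mul_self {A : Matrix n n ℂ} (hA : A.PosSemidef) :
    cfc Real.sqrt A * cfc Real.sqrt A = A := by
  rw [cfc_mul_of_isHermitian]
  conv_rhs => rw [← cfc_id_of_isHermitian hA.1]
  rw [hA.1.cfc_eq, hA.1.cfc_eq, Matrix.IsHermitian.cfc, Matrix.IsHermitian.cfc]
  congr 3
  funext i
  simp [Real.mul_self_sqrt (hA.eigenvalues_nonneg i)]

/-- This is `log x ≤ x - 1` at `x = √q / √p`. The implication `q = 0 → p = 0` excludes the case
where the convention `logb 2 0 = 0` would break the bound. -/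
theorem mul_logb_sub_mul_logb_ge {p q : ℝ} (hp : 0 ≤ p) (hq : 0 ≤ q) (h : q = 0 → p = 0) :
    (2 * p - 2 * (√p * √q)) / Real.log 2 ≤ p * Real.logb 2 p - p * Real.logb 2 q := by
  rcases hp.eq_or_lt with rfl | hp
  · simp
  have hq : 0 < q := hq.lt_of_ne fun e => hp.ne' (h e.symm)
  have hsp := Real.sqrt_pos.2 hp
  have hsq := Real.sqrt_pos.2 hq
  have h1 := Real.log_le_sub_one_of_pos (div_pos hsq hsp)
  rw [Real.log_div hsq.ne' hsp.ne', Real.log_sqrt hp.le, Real.log_sqrt hq.le] at h1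
  have h2 : 2 * p - 2 * (√p * √q) ≤ p * (Real.log p - Real.log q) := by
    have h3 : √p * √q = p * (√q / √p) := by
      field_simp
      rw [Real.sq_sqrt hp.le]
    rw [h3]
    nlinarith
  have hl : 0 < Real.log 2 := Real.log_pos (by norm_num)
  calc _ ≤ p * (Real.log p - Real.log q) / Real.log 2 := by gcongr
    _ = _ := by rw [Real.logb, Real.logb]; ring

/-- The relative entropy is bounded below by the Rényi affinity of order one half. -/
theorem relEntropy_ge {A B : Matrix n n ℂ} (hA : A.PosSemidef) (hB : B.PosSemidef)
    (hker : ∀ v, B *ᵥ v = 0 → A *ᵥ v = 0) :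
    (2 * A.trace.re - 2 * (cfc Real.sqrt A * cfc Real.sqrt B).trace.re) / Real.log 2 ≤
      relEntropy A B := by
  -- Inserting the constant function of `B` writes all the traces as double sums with the same
  -- overlap weights, so they compare termwise.
  have e0 : cfc (fun _ : ℝ => (1 : ℝ)) B = 1 := cfc_const_one ℝ B hB.1
  have e1 : A * matLog A = cfc (fun x => x * Real.logb 2 x) A * cfc (fun _ : ℝ => (1 : ℝ)) B := by
    rw [e0, mul_one, matLog]
    conv_lhs => arg 1; rw [← cfc_id_of_isHermitian hA.1]
    rw [cfc_mul_of_isHermitian]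
  have e2 : A * matLog B = cfc (fun x : ℝ => x) A * cfc (Real.logb 2) B := by
    rw [cfc_id_of_isHermitian hA.1, matLog]
  have e3 : A.trace = (cfc (fun x : ℝ => x) A * cfc (fun _ : ℝ => (1 : ℝ)) B).trace := by
    rw [e0, mul_one, cfc_id_of_isHermitian hA.1]
  rw [relEntropy, Matrix.trace_sub, e1, e2, e3]
  simp only [trace_cfc_mul_cfc hA.1 hB.1, Complex.sub_re, Complex.ofReal_re, Finset.mul_sum,
    ← Finset.sum_sub_distrib, Finset.sum_div]
  refine Finset.sum_le_sum fun i _ => Finset.sum_le_sum fun j _ => ?_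
  have hw := eigenOverlap_nonneg hA.1 hB.1 i j
  rcases hw.eq_or_lt with hw0 | hw0
  · simp [← hw0]
  have h := mul_logb_sub_mul_logb_ge (hA.eigenvalues_nonneg i) (hB.eigenvalues_nonneg j)
    fun hj => (eigenvalue_mul_eigenOverlap hA.1 hB.1 hker i j hj).resolve_right hw0.ne'
  have := mul_le_mul_of_nonneg_right h hw
  calc _ = (2 * hA.1.eigenvalues i - 2 * (√(hA.1.eigenvalues i) * √(hB.1.eigenvalues j))) /
        Real.log 2 * eigenOverlap hA.1 hB.1 i j := by ring
    _ ≤ _ := this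
    _ = _ := by ring

/-- The von Neumann entropy is bounded below by the linear entropy. -/
theorem vnEntropy_ge {A : Matrix n n ℂ} (hA : A.PosSemidef) :
    (A.trace.re - (A * A).trace.re) / Real.log 2 ≤ vnEntropy A := by
  have e1 : A * matLog A = cfc (fun x => x * Real.logb 2 x) A := by
    rw [matLog]
    conv_lhs => arg 1; rw [← cfc_id_of_isHermitian hA.1]
    rw [cfc_mul_of_isHermitian]
  have e2 : A * A = cfc (fun x : ℝ => x * x) A := by
    rw [← cfc_mul_of_isHermitian, cfc_id_of_isHermitian hA.1]
  have e3 : A.trace = (cfc (fun x : ℝ => x) A).trace := by rw [cfc_id_of_isHermitian hA.1]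
  rw [vnEntropy, e1, e2, e3]
  simp only [trace_cfc hA.1, Complex.ofReal_re, ← Finset.sum_sub_distrib, Finset.sum_div,
    ← Finset.sum_neg_distrib]
  refine Finset.sum_le_sum fun i _ => ?_
  have hl : 0 < Real.log 2 := Real.log_pos (by norm_num)
  rcases (hA.eigenvalues_nonneg i).eq_or_lt with h | h
  · simp [← h]
  · rw [Real.logb, ← mul_div_assoc, ← neg_div]
    gcongr
    nlinarith [Real.log_le_sub_one_of_pos h]

end Spectral

/-! ### Rank-one operators, support projections, and orthogonality within a PVM. -/

section LinearAlgebra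

variable {n : Type*} [Fintype n]

theorem trace_mul_eq_star_dotProduct (X : Matrix n n ℂ) (ψ : n → ℂ) :
    (X * ketbra ψ).trace = star ψ ⬝ᵥ X *ᵥ ψ := by
  rw [ketbra, Matrix.mul_vecMulVec, Matrix.trace_vecMulVec, dotProduct_comm]

theorem ketbra_isHermitian (ψ : n → ℂ) : (ketbra ψ).IsHermitian :=
  (Matrix.posSemidef_vecMulVec_self_star ψ).1

theorem ketbra_mul_mul_ketbra (X : Matrix n n ℂ) (ψ : n → ℂ) :
    ketbra ψ * X * ketbra ψ = (star ψ ⬝ᵥ X *ᵥ ψ) • ketbra ψ := by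
  ext a b
  simp only [ketbra, Matrix.mul_apply, Matrix.vecMulVec_apply, Matrix.smul_apply, smul_eq_mul,
    dotProduct, Matrix.mulVec, Finset.sum_mul, Finset.mul_sum]
  rw [Finset.sum_comm]
  refine Finset.sum_congr rfl fun _ _ => Finset.sum_congr rfl fun _ _ => ?_
  ring

theorem ketbra_mul_self {ψ : n → ℂ} (h : IsUnitVec ψ) : ketbra ψ * ketbra ψ = ketbra ψ := by
  rw [ketbra, Matrix.vecMulVec_mul_vecMulVec, show star ψ ⬝ᵥ ψ = 1 from h, one_smul]

theorem trace_ketbra {ψ : n → ℂ} (h : IsUnitVec ψ) : (ketbra ψ).trace = 1 := by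
  rw [ketbra, Matrix.trace_vecMulVec, dotProduct_comm]; exact h

theorem trace_ketbra_mul_ketbra (ψ χ : n → ℂ) :
    (ketbra ψ * ketbra χ).trace = ((‖star χ ⬝ᵥ ψ‖ ^ 2 : ℝ) : ℂ) := by
  rw [trace_mul_eq_star_dotProduct, ketbra, Matrix.vecMulVec_mulVec, ← Complex.normSq_eq_norm_sq,
    ← Complex.mul_conj, dotProduct_smul]
  have : (starRingEnd ℂ) (star χ ⬝ᵥ ψ) = star ψ ⬝ᵥ χ := by
    rw [starRingEnd_apply, Matrix.star_dotProduct, star_star, dotProduct_comm]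
  rw [this]
  simp

theorem re_trace_conjTranspose_mul_self_nonneg {m : Type*} [Fintype m] (X : Matrix m n ℂ) :
    0 ≤ (Xᴴ * X).trace.re :=
  (Complex.nonneg_iff.1 (Matrix.posSemidef_conjTranspose_mul_self X).trace_nonneg).1

variable [DecidableEq n]

/-- The trace is the squared Hilbert-Schmidt norm of `√A * √B`. -/
theorem mul_eq_zero_of_trace_mul_eq_zero {A B : Matrix n n ℂ} (hA : A.PosSemidef)
    (hB : B.PosSemidef) (h : (A * B).trace = 0) : A * B = 0 := by
  set S := cfc Real.sqrt A
  set T := cfc Real.sqrt B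
  have hS : Sᴴ = S := isHermitian_cfc _ _
  have hT : Tᴴ = T := isHermitian_cfc _ _
  have hSA : S * S = A := cfc_sqrt_mul_self hA
  have hTB : T * T = B := cfc_sqrt_mul_self hB
  have h1 : ((S * T)ᴴ * (S * T)).trace = 0 := by
    rw [← h, Matrix.conjTranspose_mul, hS, hT, Matrix.mul_assoc, Matrix.trace_mul_comm T,
      ← hSA, ← hTB]
    simp only [Matrix.mul_assoc]
  rw [Matrix.trace_conjTranspose_mul_self_eq_zero_iff] at h1
  rw [← hSA, ← hTB, Matrix.mul_assoc, ← Matrix.mul_assoc S T T, h1]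
  simp

/-- The projection onto the range of a Hermitian matrix. -/
noncomputable def suppProj (A : Matrix n n ℂ) : Matrix n n ℂ :=
  cfc (fun x : ℝ => x * x⁻¹) A

theorem suppProj_isHermitian (A : Matrix n n ℂ) : (suppProj A).IsHermitian :=
  isHermitian_cfc _ _

theorem suppProj_eq {A : Matrix n n ℂ} (hA : A.IsHermitian) :
    suppProj A = A * cfc (fun x : ℝ => x⁻¹) A := by
  conv_rhs => arg 1; rw [← cfc_id_of_isHermitian hA]
  rw [cfc_mul_of_isHermitian, suppProj]

theorem suppProj_mul_self (A : Matrix n n ℂ) : suppProj A * suppProj A = suppProj A := by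
  rw [suppProj, cfc_mul_of_isHermitian]
  congr 1
  funext x
  by_cases h : x = 0 <;> simp [h]

theorem mul_suppProj {A : Matrix n n ℂ} (hA : A.IsHermitian) : A * suppProj A = A := by
  conv_lhs => arg 1; rw [← cfc_id_of_isHermitian hA]
  rw [suppProj, cfc_mul_of_isHermitian]
  conv_rhs => rw [← cfc_id_of_isHermitian hA]
  congr 1
  funext x
  by_cases h : x = 0 <;> simp [h]

/-- The difference of the two sides is the squared Hilbert-Schmidt norm of `(1 - Q) * A * Q`. -/
theorem re_trace_compression_le {Q A : Matrix n n ℂ} (hQ : Q.IsHermitian) (hQQ : Q * Q = Q)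
    (hA : A.IsHermitian) : (Q * A * Q * A).trace.re ≤ (Q * A * A).trace.re := by
  have h := re_trace_conjTranspose_mul_self_nonneg ((1 - Q) * A * Q)
  have h1 : (1 - Q)ᴴ = 1 - Q := by rw [Matrix.conjTranspose_sub, Matrix.conjTranspose_one, hQ.eq]
  have h2 : (1 - Q) * (1 - Q) = 1 - Q := IsIdempotentElem.one_sub hQQ
  have h3 : ((1 - Q) * A * Q)ᴴ * ((1 - Q) * A * Q) = Q * (A * A - A * Q * A) * Q := by
    rw [Matrix.conjTranspose_mul, Matrix.conjTranspose_mul, h1, hA.eq, hQ.eq]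
    calc _ = Q * (A * ((1 - Q) * (1 - Q)) * A) * Q := by simp only [Matrix.mul_assoc]
      _ = _ := by rw [h2]; noncomm_ring
  rw [h3, Matrix.trace_mul_cycle, hQQ, mul_sub, Matrix.trace_sub, Complex.sub_re] at h
  simp only [Matrix.mul_assoc] at h ⊢
  linarith

/-- Sandwiching `∑ k, P k = 1` between two copies of `P j` leaves `∑ P j * P k * P j = 0` over `k ≠
j`. Each term is positive semidefinite, hence zero. -/
theorem IsPVM.mul_eq_zero {o : Type*} [Fintype o] {P : o → Matrix n n ℂ} (hP : IsPVM P)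
    {i j : o} (hij : i ≠ j) : P i * P j = 0 := by
  classical
  have hH : ∀ i, (P i)ᴴ = P i := fun i => (hP.1.1 i).1
  have h1 : ∀ k, (P k * P j)ᴴ * (P k * P j) = P j * P k * P j := by
    intro k
    rw [Matrix.conjTranspose_mul, hH, hH]
    calc _ = P j * (P k * P k) * P j := by simp only [Matrix.mul_assoc]
      _ = _ := by rw [hP.2]
  have h2 : ∑ k, P j * P k * P j = P j := by
    rw [← Finset.sum_mul, ← Finset.mul_sum, hP.1.2, mul_one, hP.2]
  rw [← Finset.add_sum_erase _ _ (Finset.mem_univ j), hP.2, hP.2, add_eq_left] at h2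
  have h3 := congrArg Matrix.trace h2
  rw [Matrix.trace_sum, Matrix.trace_zero] at h3
  have h4 := (Finset.sum_eq_zero_iff_of_nonneg fun k _ => by
    rw [← h1]; exact (Matrix.posSemidef_conjTranspose_mul_self _).trace_nonneg).1 h3 i
      (Finset.mem_erase.2 ⟨hij, Finset.mem_univ _⟩)
  rwa [← h1, Matrix.trace_conjTranspose_mul_self_eq_zero_iff] at h4

end LinearAlgebra

/-! ### Rigidity of the Naimark extensions of a SIC measurement. -/

section Frame

variable {d : ℕ} {φ : Fin (d ^ 2) → Fin d → ℂ}

/-- The vectors underlying a SIC measurement on `ℂ^d`. -/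
structure IsSICFrame (φ : Fin (d ^ 2) → Fin d → ℂ) : Prop where
  isUnitVec : ∀ i, IsUnitVec (φ i)
  overlap : ∀ i j, i ≠ j → ‖star (φ j) ⬝ᵥ φ i‖ ^ 2 = 1 / ((d : ℝ) + 1)
  sum_ketbra : ∑ i, ketbra (φ i) = (d : ℂ) • (1 : Matrix (Fin d) (Fin d) ℂ)
  pos : 0 < d

theorem IsSIC.exists_frame {M : Fin (d ^ 2) → Matrix (Fin d) (Fin d) ℂ} (hM : IsSIC M)
    (hd : 0 < d) : ∃ φ, IsSICFrame φ ∧ ∀ i, M i = (1 / (d : ℂ)) • ketbra (φ i) := by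
  obtain ⟨hPOVM, φ, h1, h2, h3⟩ := hM
  refine ⟨φ, ⟨h1, h2, ?_, hd⟩, h3⟩
  have hd' : (d : ℂ) ≠ 0 := Nat.cast_ne_zero.2 hd.ne'
  rw [← hPOVM.2]
  simp only [h3, ← Finset.smul_sum, smul_smul]
  rw [mul_one_div_cancel hd', one_smul]

/-- The Gram matrix of the projections is `d/(d+1)` times the identity plus `1/(d+1)` times the
all-ones matrix; the trace of the relation removes the second part. -/
theorem IsSICFrame.eq_zero (hφ : IsSICFrame φ) (c : Fin (d ^ 2) → ℂ)
    (h : ∑ i, c i • ketbra (φ i) = 0) (j : Fin (d ^ 2)) : c j = 0 := by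
  have h1 : ∑ i, c i = 0 := by
    have := congrArg Matrix.trace h
    simpa [Matrix.trace_sum, Matrix.trace_smul, trace_ketbra (hφ.isUnitVec _)] using this
  have h2 : ∑ i, c i * (ketbra (φ i) * ketbra (φ j)).trace = 0 := by
    have := congrArg (fun X => (X * ketbra (φ j)).trace) h
    simpa [Finset.sum_mul, Matrix.trace_sum, Matrix.trace_smul] using this
  have hd : (d : ℂ) + 1 ≠ 0 := by exact_mod_cast Nat.succ_ne_zero d
  have hd' : (d : ℂ) ≠ 0 := Nat.cast_ne_zero.2 hφ.pos.ne'
  have h3 : ∀ i, c i * (ketbra (φ i) * ketbra (φ j)).trace =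
      c i * (1 / ((d : ℂ) + 1)) + if i = j then c i * (d / ((d : ℂ) + 1)) else 0 := by
    intro i
    by_cases hij : i = j
    · subst hij
      rw [if_pos rfl, ketbra_mul_self (hφ.isUnitVec i), trace_ketbra (hφ.isUnitVec i)]
      field_simp
      ring
    · rw [if_neg hij, trace_ketbra_mul_ketbra, hφ.overlap i j hij]
      push_cast
      ring
  simp only [h3, Finset.sum_add_distrib, ← Finset.sum_mul, h1, zero_mul, zero_add,
    Finset.sum_ite_eq', Finset.mem_univ, if_true] at h2
  exact (mul_eq_zero.1 h2).resolve_right (div_ne_zero hd' hd)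

/-- Each `N i` is a multiple of its projection; as the projections sum to `d`, the coefficients `c /
d` give the right sum, and independence makes them the only ones. -/
theorem IsSICFrame.eq_smul_ketbra (hφ : IsSICFrame φ) {N : Fin (d ^ 2) → Matrix (Fin d) (Fin d) ℂ}
    {c : ℂ} (hN : ∀ i, ketbra (φ i) * N i * ketbra (φ i) = N i) (hsum : ∑ i, N i = c • 1)
    (i : Fin (d ^ 2)) : N i = (c / d) • ketbra (φ i) := by
  have hd' : (d : ℂ) ≠ 0 := Nat.cast_ne_zero.2 hφ.pos.ne'
  have h1 : ∀ i, N i = (star (φ i) ⬝ᵥ N i *ᵥ φ i) • ketbra (φ i) := fun i => by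
    rw [← ketbra_mul_mul_ketbra, hN]
  have h2 : ∑ i, ((star (φ i) ⬝ᵥ N i *ᵥ φ i) - c / d) • ketbra (φ i) = 0 := by
    simp only [sub_smul, Finset.sum_sub_distrib, ← h1, hsum, ← Finset.smul_sum, hφ.sum_ketbra,
      smul_smul]
    rw [div_mul_cancel₀ _ hd', sub_self]
  have h3 := hφ.eq_zero _ h2 i
  rw [h1 i, sub_eq_zero.1 h3]

theorem posSemidef_one_sub_ketbra {n : Type*} [Fintype n] [DecidableEq n] {ψ : n → ℂ}
    (h : IsUnitVec ψ) : (1 - ketbra ψ).PosSemidef := by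
  have : (1 - ketbra ψ) = (1 - ketbra ψ)ᴴ * (1 - ketbra ψ) := by
    rw [Matrix.conjTranspose_sub, Matrix.conjTranspose_one, (ketbra_isHermitian ψ).eq]
    exact (IsIdempotentElem.one_sub (ketbra_mul_self h)).symm
  rw [this]
  exact Matrix.posSemidef_conjTranspose_mul_self _

theorem trace_traceQ_mul {ι κ : Type*} [Fintype ι] [Fintype κ] [DecidableEq κ]
    (X : Matrix (ι × κ) (ι × κ) ℂ) (Y : Matrix ι ι ℂ) :
    (traceQ X * Y).trace = (X * (Y ⊗ₖ (1 : Matrix κ κ ℂ))).trace := by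
  simp only [Matrix.trace, Matrix.diag_apply, Matrix.mul_apply, traceQ, Matrix.of_apply,
    Fintype.sum_prod_type, Matrix.kroneckerMap_apply, Matrix.one_apply, mul_ite, mul_one, mul_zero,
    Finset.sum_ite_eq', Finset.mem_univ, if_true, Finset.sum_mul]
  exact Finset.sum_congr rfl fun a _ => Finset.sum_comm

variable {κ : Type*} [Fintype κ] [DecidableEq κ]
  {P : Fin (d ^ 2) → Matrix (Fin d × κ) (Fin d × κ) ℂ} {σ : Matrix κ κ ℂ}

/-- On the support of the ancilla state, every Naimark extension of a SIC measurement compresses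
to the same product operators. -/
theorem IsSICFrame.compression_eq (hφ : IsSICFrame φ)
    (h : IsNaimarkExtension (fun i => (1 / (d : ℂ)) • ketbra (φ i)) P σ) (i : Fin (d ^ 2)) :
    (1 ⊗ₖ suppProj σ) * P i * (1 ⊗ₖ suppProj σ) =
      (1 / (d : ℂ)) • (ketbra (φ i) ⊗ₖ suppProj σ) := by
  obtain ⟨hP, hσ, hM⟩ := h
  set E := suppProj σ with hE
  set G : Matrix (Fin d × κ) (Fin d × κ) ℂ := 1 ⊗ₖ E with hG
  have hEH : Eᴴ = E := suppProj_isHermitian σ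
  have hGH : Gᴴ = G := by rw [hG, Matrix.conjTranspose_kronecker, hEH, Matrix.conjTranspose_one]
  have hGG : G * G = G := by
    rw [hG, ← Matrix.mul_kronecker_mul, suppProj_mul_self, Matrix.one_mul]
  -- The trace of this product of positive matrices equals `tr (M i (1 - |φ i⟩⟨φ i|))`, which
  -- vanishes.
  have hPσ : ∀ i, P i * ((1 - ketbra (φ i)) ⊗ₖ σ) = 0 := by
    intro i
    refine mul_eq_zero_of_trace_mul_eq_zero (hP.1.1 i)
      ((posSemidef_one_sub_ketbra (hφ.isUnitVec i)).kronecker hσ.1) ?_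
    have := trace_traceQ_mul (P i * (1 ⊗ₖ σ)) (1 - ketbra (φ i))
    rw [Matrix.mul_assoc, ← Matrix.mul_kronecker_mul, Matrix.one_mul, Matrix.mul_one, ← hM] at this
    rw [← this]
    simp [mul_sub, ketbra_mul_self (hφ.isUnitVec i)]
  have hPG : ∀ i, P i * G = P i * (ketbra (φ i) ⊗ₖ E) := by
    intro i
    -- Multiplying by the pseudo-inverse of `σ` replaces `σ` by its support projection.
    have h1 : (P i * ((1 - ketbra (φ i)) ⊗ₖ σ)) * (1 ⊗ₖ cfc (fun x : ℝ => x⁻¹) σ) = 0 := by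
      rw [hPσ, zero_mul]
    rw [Matrix.mul_assoc, ← Matrix.mul_kronecker_mul, ← suppProj_eq hσ.1.1, Matrix.mul_one,
      show (1 - ketbra (φ i)) ⊗ₖ suppProj σ = G - ketbra (φ i) ⊗ₖ suppProj σ by
        ext x y; simp [hG, hE, sub_mul],
      mul_sub, sub_eq_zero] at h1
    exact h1
  have hR : ∀ i, (G * P i * G) * (ketbra (φ i) ⊗ₖ 1) = G * P i * G := by
    intro i
    rw [Matrix.mul_assoc, hG, ← Matrix.mul_kronecker_mul, Matrix.one_mul, Matrix.mul_one,
      Matrix.mul_assoc, Matrix.mul_assoc, ← hPG]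
  have hQH : ∀ i, (ketbra (φ i) ⊗ₖ (1 : Matrix κ κ ℂ))ᴴ = ketbra (φ i) ⊗ₖ 1 := by
    intro i
    rw [Matrix.conjTranspose_kronecker, (ketbra_isHermitian _).eq, Matrix.conjTranspose_one]
  have hWH : ∀ i, (G * P i * G)ᴴ = G * P i * G := by
    intro i
    rw [Matrix.conjTranspose_mul, Matrix.conjTranspose_mul, hGH, (hP.1.1 i).1, Matrix.mul_assoc]
  have hL : ∀ i, (ketbra (φ i) ⊗ₖ 1) * (G * P i * G) = G * P i * G := by
    intro i
    have := congrArg Matrix.conjTranspose (hR i)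
    rwa [Matrix.conjTranspose_mul, hWH, hQH] at this
  have hsum : ∑ i, G * P i * G = G := by
    rw [← Finset.sum_mul, ← Finset.mul_sum, hP.1.2, mul_one, hGG]
  ext ⟨a, s⟩ ⟨b, t⟩
  -- For fixed ancilla indices `s`, `t`, the blocks of `G * P i * G` are compressed by `|φ i⟩⟨φ i|`
  -- and sum to `E s t • 1`.
  have key := hφ.eq_smul_ketbra (N := fun i => Matrix.of fun a b => (G * P i * G) (a, s) (b, t))
    (c := E s t) ?_ ?_ i
  · have := congrFun (congrFun key a) b
    rw [Matrix.of_apply] at this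
    rw [this]
    simp only [Matrix.smul_apply, Matrix.kroneckerMap_apply, smul_eq_mul]
    ring
  · intro i
    have h2 : (ketbra (φ i) ⊗ₖ 1) * (G * P i * G) * (ketbra (φ i) ⊗ₖ 1) = G * P i * G := by
      rw [hL, hR]
    ext a b
    rw [Matrix.of_apply]
    conv_rhs => rw [← h2]
    generalize G * P i * G = W
    simp [Matrix.mul_apply, Fintype.sum_prod_type, Matrix.kroneckerMap_apply, Matrix.one_apply]
  · ext a b
    have := congrFun (congrFun hsum (a, s)) (b, t)
    rw [Matrix.sum_apply] at this ⊢
    simp only [Matrix.of_apply]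
    rw [this, hG, Matrix.kroneckerMap_apply, Matrix.smul_apply, smul_eq_mul, mul_comm]

theorem trace_dephase_mul_dephase {n o : Type*} [Fintype n] [DecidableEq n] [Fintype o]
    {P : o → Matrix n n ℂ} (hP : IsPVM P) (A : Matrix n n ℂ) :
    (dephase P A * dephase P A).trace = ∑ i, (P i * A * P i * A).trace := by
  simp only [dephase, Finset.sum_mul, Matrix.trace_sum]
  refine Finset.sum_congr rfl fun i _ => ?_
  rw [Finset.mul_sum, Matrix.trace_sum, Finset.sum_eq_single i]
  · rw [show P i * A * P i * (P i * A * P i) = P i * A * (P i * P i) * A * P i by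
      simp only [Matrix.mul_assoc], hP.2, Matrix.trace_mul_comm]
    simp only [← Matrix.mul_assoc, hP.2]
  · intro j _ hj
    have h0 := hP.mul_eq_zero (Ne.symm hj)
    rw [show P i * A * P i * (P j * A * P j) = P i * A * (P i * P j) * A * P j by
      simp only [Matrix.mul_assoc], h0]
    simp
  · simp

theorem IsSICFrame.re_trace_dephase_sq_le (hφ : IsSICFrame φ)
    (h : IsNaimarkExtension (fun i => (1 / (d : ℂ)) • ketbra (φ i)) P σ)
    {A : Matrix (Fin d × κ) (Fin d × κ) ℂ} (hA : A.IsHermitian)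
    (hAG : A * (1 ⊗ₖ suppProj σ) = A) (htr : (A * A).trace = 1) :
    (dephase P A * dephase P A).trace.re ≤ 1 / d := by
  set G : Matrix (Fin d × κ) (Fin d × κ) ℂ := 1 ⊗ₖ suppProj σ with hG
  have hGH : Gᴴ = G := by
    rw [hG, Matrix.conjTranspose_kronecker, (suppProj_isHermitian σ).eq, Matrix.conjTranspose_one]
  have hGA : G * A = A := by
    have := congrArg Matrix.conjTranspose hAG
    rwa [Matrix.conjTranspose_mul, hGH, hA.eq] at this
  set Q : Fin (d ^ 2) → Matrix (Fin d × κ) (Fin d × κ) ℂ := fun i => ketbra (φ i) ⊗ₖ 1 with hQ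
  have hQG : ∀ i, ketbra (φ i) ⊗ₖ suppProj σ = Q i * G := by
    intro i
    rw [hQ, hG, ← Matrix.mul_kronecker_mul, Matrix.one_mul, Matrix.mul_one]
  -- Because `A` lives under `G`, both copies of `P i` may be replaced by their compressions, each
  -- contributing a factor `1/d`. Summing later uses `∑ Q i = d`, hence the final `1/d`.
  have hterm : ∀ i, (P i * A * P i * A).trace.re ≤ (1 / d ^ 2 : ℝ) * (Q i * A * A).trace.re := by
    intro i
    have hc := hφ.compression_eq h i
    rw [← hG, hQG] at hc
    have e1 : (P i * A * P i * A).trace = (G * P i * G * A * (G * P i * G) * A).trace := by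
      have : G * P i * G * A * (G * P i * G) * A = G * (P i * (G * A * G) * P i * (G * A)) := by
        simp only [Matrix.mul_assoc]
      rw [this, Matrix.trace_mul_comm G, hGA, hAG, Matrix.mul_assoc _ A G, hAG]
    have e2 : G * P i * G * A * (G * P i * G) * A =
        ((1 / d ^ 2 : ℝ) : ℂ) • (Q i * A * Q i * A) := by
      rw [hc]
      simp only [Matrix.smul_mul, Matrix.mul_smul, smul_smul, Matrix.mul_assoc, hGA]
      congr 1
      push_cast
      ring
    rw [e1, e2, Matrix.trace_smul, smul_eq_mul, Complex.re_ofReal_mul]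
    refine mul_le_mul_of_nonneg_left (re_trace_compression_le ?_ ?_ hA) (by positivity)
    · rw [Matrix.IsHermitian, hQ, Matrix.conjTranspose_kronecker, (ketbra_isHermitian _).eq,
        Matrix.conjTranspose_one]
    · rw [hQ, ← Matrix.mul_kronecker_mul, ketbra_mul_self (hφ.isUnitVec i), Matrix.one_mul]
  have hQsum : ∑ i, Q i = (d : ℂ) • 1 := by
    have e : ∑ i, Q i = (∑ i, ketbra (φ i)) ⊗ₖ 1 := by
      ext x y
      simp [hQ, Matrix.sum_apply, Matrix.kroneckerMap_apply, Finset.sum_mul]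
    rw [e, hφ.sum_ketbra, Matrix.smul_kronecker, Matrix.one_kronecker_one]
  rw [trace_dephase_mul_dephase h.1, Complex.re_sum]
  calc _ ≤ ∑ i, (1 / d ^ 2 : ℝ) * (Q i * A * A).trace.re :=
        Finset.sum_le_sum fun i _ => hterm i
    _ = (1 / d ^ 2 : ℝ) * ((∑ i, Q i) * (A * A)).trace.re := by
        rw [Finset.sum_mul, Matrix.trace_sum, Complex.re_sum, Finset.mul_sum]
        simp only [Matrix.mul_assoc]
    _ = 1 / d := by
        rw [hQsum, Matrix.smul_mul, Matrix.one_mul, Matrix.trace_smul, htr]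
        simp
        field_simp

end Frame

/-! ### Dephasing, the entropy bounds it yields, and pure-state decompositions. -/

section Dephasing

variable {n o : Type*} [Fintype n] [DecidableEq n] [Fintype o] {P : o → Matrix n n ℂ}

theorem IsPVM.posSemidef_dephase (hP : IsPVM P) {A : Matrix n n ℂ} (hA : A.PosSemidef) :
    (dephase P A).PosSemidef := by
  refine Matrix.posSemidef_sum _ fun i _ => ?_
  have := hA.mul_mul_conjTranspose_same (P i)
  rwa [(hP.1.1 i).1] at this

theorem IsPVM.trace_dephase (hP : IsPVM P) (A : Matrix n n ℂ) :
    (dephase P A).trace = A.trace := by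
  rw [dephase, Matrix.trace_sum]
  have : ∀ i, (P i * A * P i).trace = (P i * A).trace := fun i => by
    rw [Matrix.trace_mul_comm, ← Matrix.mul_assoc, hP.2]
  simp only [this]
  rw [← Matrix.trace_sum, ← Finset.sum_mul, hP.1.2, one_mul]

theorem IsPVM.commute_dephase (hP : IsPVM P) (A : Matrix n n ℂ) (i : o) :
    Commute (dephase P A) (P i) := by
  have h1 : dephase P A * P i = P i * A * P i := by
    rw [dephase, Finset.sum_mul, Finset.sum_eq_single i]
    · rw [Matrix.mul_assoc, hP.2]
    · intro j _ hj
      rw [Matrix.mul_assoc, hP.mul_eq_zero hj, mul_zero]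
    · simp
  have h2 : P i * dephase P A = P i * A * P i := by
    rw [dephase, Finset.mul_sum, Finset.sum_eq_single i]
    · rw [← Matrix.mul_assoc, ← Matrix.mul_assoc, hP.2]
    · intro j _ hj
      rw [← Matrix.mul_assoc, ← Matrix.mul_assoc, hP.mul_eq_zero hj.symm]
      simp
    · simp
  exact h1.trans h2.symm

/-- `Δ_P` is the trace-preserving conditional expectation onto the commutant of the `P i`. -/
theorem IsPVM.trace_dephase_mul (hP : IsPVM P) (A : Matrix n n ℂ) {B : Matrix n n ℂ}
    (hB : ∀ i, Commute B (P i)) : (dephase P A * B).trace = (A * B).trace := by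
  rw [dephase, Finset.sum_mul, Matrix.trace_sum]
  have : ∀ i, (P i * A * P i * B).trace = (A * B * P i).trace := fun i => by
    rw [Matrix.mul_assoc _ (P i), ← (hB i).eq, Matrix.mul_assoc, Matrix.trace_mul_comm,
      Matrix.mul_assoc, Matrix.mul_assoc, hP.2, Matrix.mul_assoc]
  simp only [this]
  rw [← Matrix.trace_sum, ← Finset.mul_sum, hP.1.2, mul_one]

/-- The relative entropy of coherence is bounded below by the Hilbert-Schmidt weight of the
off-diagonal blocks of the square root of the state. -/
theorem IsPVM.pvmRq_ge (hP : IsPVM P) {τ : Matrix n n ℂ} (hτ : IsState τ) :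
    (1 - (dephase P (cfc Real.sqrt τ) * dephase P (cfc Real.sqrt τ)).trace.re) / Real.log 2 ≤
      pvmRq P τ := by
  set A := cfc Real.sqrt τ
  set D := dephase P τ
  have hD : D.PosSemidef := hP.posSemidef_dephase hτ.1
  set B := cfc Real.sqrt D
  have hAH : A.IsHermitian := isHermitian_cfc _ _
  have hBH : B.IsHermitian := isHermitian_cfc _ _
  have hcomm : ∀ i, Commute B (P i) := fun i =>
    Commute.cfc_real (a := D) (hP.commute_dephase τ i) Real.sqrt
  have hBB : (B * B).trace = 1 := by
    rw [cfc_sqrt_mul_self hD, hP.trace_dephase, hτ.2]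
  have hΔ : (dephase P A)ᴴ = dephase P A := by
    simp [dephase, Matrix.conjTranspose_sum, Matrix.conjTranspose_mul, hAH.eq,
      fun i => (hP.1.1 i).1.eq, Matrix.mul_assoc]
  -- Expanding `‖Δ_P(A) - B‖² ≥ 0`, with `tr (Δ_P(A) B) = tr (A B)` and `tr B² = 1`, gives `2 tr (A
  -- B) ≤ tr Δ_P(A)² + 1`, which bounds the affinity.
  have h1 := re_trace_conjTranspose_mul_self_nonneg (dephase P A - B)
  rw [Matrix.conjTranspose_sub, hΔ, hBH.eq, mul_sub, sub_mul, sub_mul, Matrix.trace_sub,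
    Matrix.trace_sub, Matrix.trace_sub, hBB, Matrix.trace_mul_comm B,
    hP.trace_dephase_mul A hcomm] at h1
  simp only [Complex.sub_re, Complex.one_re] at h1
  refine le_trans ?_ (relEntropy_ge hτ.1 hD (ker_dephase P hP τ hτ))
  have hl : 0 < Real.log 2 := Real.log_pos (by norm_num)
  rw [hτ.2]
  rw [Complex.one_re]
  exact div_le_div_of_nonneg_right (by linarith) hl.le

theorem IsPVM.vnEntropy_dephase_ketbra_ge (hP : IsPVM P) {ψ : n → ℂ} (hψ : IsUnitVec ψ) :
    (1 - (dephase P (ketbra ψ) * dephase P (ketbra ψ)).trace.re) / Real.log 2 ≤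
      vnEntropy (dephase P (ketbra ψ)) := by
  have := vnEntropy_ge (hP.posSemidef_dephase (Matrix.posSemidef_vecMulVec_self_star ψ))
  change ((dephase P (ketbra ψ)).trace.re - _) / _ ≤ _ at this
  rwa [hP.trace_dephase, trace_ketbra hψ, Complex.one_re] at this

theorem IsState.exists_pure_decomposition {τ : Matrix n n ℂ} (hτ : IsState τ) :
    ∃ (k : ℕ) (q : Fin k → ℝ) (ψ : Fin k → n → ℂ), (∀ j, 0 ≤ q j) ∧ ∑ j, q j = 1 ∧
      (∀ j, IsUnitVec (ψ j)) ∧ τ = ∑ j, (q j : ℂ) • ketbra (ψ j) := by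
  have hH := hτ.1.1
  let e := (Fintype.equivFin n).symm
  refine ⟨Fintype.card n, fun j => hH.eigenvalues (e j), fun j => hH.eigenvectorBasis (e j),
    fun j => hτ.1.eigenvalues_nonneg _, ?_, ?_, ?_⟩
  · rw [e.sum_comp hH.eigenvalues]
    have := hτ.2
    rw [hH.trace_eq_sum_eigenvalues] at this
    simpa using congrArg Complex.re this
  · intro j
    have := hH.eigenvectorBasis.orthonormal.1 (e j)
    have h2 := inner_self_eq_norm_sq_to_K (𝕜 := ℂ) (hH.eigenvectorBasis (e j))
    rw [this, EuclideanSpace.inner_eq_star_dotProduct, dotProduct_comm] at h2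
    rw [IsUnitVec]
    simpa using h2
  · rw [e.sum_comp fun i => ((hH.eigenvalues i : ℝ) : ℂ) • ketbra (hH.eigenvectorBasis i)]
    have h := hH.spectral_theorem
    rw [Unitary.conjStarAlgAut_apply] at h
    conv_lhs => rw [h]
    ext a b
    rw [Matrix.mul_apply, Matrix.sum_apply]
    refine Finset.sum_congr rfl fun i _ => ?_
    rw [Matrix.mul_diagonal, Matrix.smul_apply, ketbra, Matrix.vecMulVec_apply, Matrix.star_apply,
      smul_eq_mul]
    change hH.eigenvectorBasis i a * (hH.eigenvalues i : ℂ) * star (hH.eigenvectorBasis i b) =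
      (hH.eigenvalues i : ℂ) * (hH.eigenvectorBasis i a * star (hH.eigenvectorBasis i b))
    ring

/-- Pure states of positive weight lie in the support of `τ`: the positive operators `Fᴴ |ψ j⟩⟨ψ j|
F` have weighted traces summing to zero. Applied with `F = 1 - G`. -/
theorem ketbra_mul_eq_of_decomposition {τ F : Matrix n n ℂ} {k : ℕ} {q : Fin k → ℝ}
    {ψ : Fin k → n → ℂ} (hq : ∀ j, 0 ≤ q j) (hτ : τ = ∑ j, (q j : ℂ) • ketbra (ψ j))
    (hF : τ * F = 0) (j : Fin k) (hj : 0 < q j) : ketbra (ψ j) * F = 0 := by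
  have hpsd : ∀ j, (Fᴴ * ketbra (ψ j) * F).PosSemidef := fun j =>
    (Matrix.posSemidef_vecMulVec_self_star (ψ j)).conjTranspose_mul_mul_same F
  have h1 : ∑ j, (q j : ℂ) * (Fᴴ * ketbra (ψ j) * F).trace = 0 := by
    have h2 : (Fᴴ * (τ * F)).trace = 0 := by rw [hF, mul_zero, Matrix.trace_zero]
    rw [hτ] at h2
    simpa [Finset.sum_mul, Finset.mul_sum, Matrix.trace_sum, Matrix.mul_assoc] using h2
  have h3 := (Finset.sum_eq_zero_iff_of_nonneg fun j _ =>
    mul_nonneg (Complex.zero_le_real.2 (hq j)) (hpsd j).trace_nonneg).1 h1 j (Finset.mem_univ j)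
  have h4 := (mul_eq_zero.1 h3).resolve_left (by exact_mod_cast hj.ne')
  rw [(hpsd j).trace_eq_zero_iff, ketbra, Matrix.mul_vecMulVec, Matrix.vecMulVec_mul] at h4
  rw [ketbra, Matrix.vecMulVec_mul]
  have h5 : star (ψ j) ᵥ* F = star (Fᴴ *ᵥ ψ j) := by
    rw [Matrix.star_mulVec, Matrix.conjTranspose_conjTranspose]
  rw [h5] at h4 ⊢
  have h6 : Fᴴ *ᵥ ψ j = 0 := by
    have := congrArg Matrix.trace h4
    rw [Matrix.trace_vecMulVec, Matrix.trace_zero] at this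
    exact dotProduct_self_star_eq_zero.1 this
  rw [h6]
  ext a b
  simp [Matrix.vecMulVec_apply]

end Dephasing

theorem IsState.kronecker {ι κ : Type*} [Fintype ι] [Fintype κ] [DecidableEq ι] [DecidableEq κ]
    {ρ : Matrix ι ι ℂ} {σ : Matrix κ κ ℂ}
    (hρ : IsState ρ) (hσ : IsState σ) : IsState (ρ ⊗ₖ σ) :=
  ⟨hρ.1.kronecker hσ.1, by rw [Matrix.trace_kronecker, hρ.2, hσ.2, one_mul]⟩

/-- A lower bound, uniform in the ancilla, on the randomness of every Naimark extension of a
SIC measurement. -/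
theorem IsSICFrame.pvmRandomness_ge {d : ℕ} {φ : Fin (d ^ 2) → Fin d → ℂ} (hφ : IsSICFrame φ)
    {κ : Type*} [Fintype κ] [DecidableEq κ]
    {P : Fin (d ^ 2) → Matrix (Fin d × κ) (Fin d × κ) ℂ} {σ : Matrix κ κ ℂ}
    (h : IsNaimarkExtension (fun i => (1 / (d : ℂ)) • ketbra (φ i)) P σ)
    {ρ : Matrix (Fin d) (Fin d) ℂ} (hρ : IsState ρ) (t : RandomnessKind) :
    (1 - 1 / (d : ℝ)) / Real.log 2 ≤ pvmRandomness t P (ρ ⊗ₖ σ) := by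
  have hl : 0 < Real.log 2 := Real.log_pos (by norm_num)
  have hσ := h.2.1
  have hτ := hρ.kronecker hσ
  set τ := ρ ⊗ₖ σ with hτdef
  set G : Matrix (Fin d × κ) (Fin d × κ) ℂ := 1 ⊗ₖ suppProj σ with hG
  have hτG : τ * G = τ := by
    rw [hτdef, hG, ← Matrix.mul_kronecker_mul, Matrix.mul_one, mul_suppProj hσ.1.1]
  have hτF : τ * (1 - G) = 0 := by rw [mul_sub, mul_one, hτG, sub_self]
  cases t with
  | q =>
    refine le_trans ?_ (h.1.pvmRq_ge hτ)
    have hAH : (cfc Real.sqrt τ).IsHermitian := isHermitian_cfc _ _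
    have hA2 := cfc_sqrt_mul_self hτ.1
    -- The squared Hilbert-Schmidt norm of this product is `tr ((1 - G) τ (1 - G)) = 0`.
    have hAF : cfc Real.sqrt τ * (1 - G) = 0 := by
      rw [← Matrix.trace_conjTranspose_mul_self_eq_zero_iff, Matrix.conjTranspose_mul, hAH.eq,
        Matrix.mul_assoc, ← Matrix.mul_assoc (cfc Real.sqrt τ), hA2, hτF, mul_zero,
        Matrix.trace_zero]
    rw [mul_sub, mul_one, sub_eq_zero] at hAF
    have := hφ.re_trace_dephase_sq_le h hAH hAF.symm (by rw [hA2, hτ.2])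
    gcongr
  | c =>
    -- One decomposition is needed for the set to be nonempty, since `sInf ∅ = 0`.
    obtain ⟨k, q, ψ, h1, h2, h3, h4⟩ := hτ.exists_pure_decomposition
    refine le_csInf ⟨_, k, q, ψ, h1, h2, h3, h4, rfl⟩ ?_
    rintro r ⟨k, q, ψ, hq, hq1, hψ, hdec, rfl⟩
    calc _ = ∑ j, q j * ((1 - 1 / (d : ℝ)) / Real.log 2) := by
          rw [← Finset.sum_mul, hq1, one_mul]
      _ ≤ _ := Finset.sum_le_sum fun j _ => ?_
    rcases (hq j).eq_or_lt with hj | hj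
    · simp [← hj]
    refine mul_le_mul_of_nonneg_left ?_ hj.le
    refine le_trans ?_ (h.1.vnEntropy_dephase_ketbra_ge (hψ j))
    have hAF := ketbra_mul_eq_of_decomposition hq hdec hτF j hj
    rw [mul_sub, mul_one, sub_eq_zero] at hAF
    have := hφ.re_trace_dephase_sq_le h (ketbra_isHermitian (ψ j)) hAF.symm
      (by rw [ketbra_mul_self (hψ j), trace_ketbra (hψ j)])
    gcongr

/-! ### Existence of Naimark extensions. -/

section Naimark

/-- The operator swapping the ranges of two orthogonal isometries and fixing the orthogonal
complement of these ranges. -/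
def swapUnitary {m n : Type*} [Fintype n] [DecidableEq m] (J V : Matrix m n ℂ) : Matrix m m ℂ :=
  J * Vᴴ + V * Jᴴ + (1 - J * Jᴴ - V * Vᴴ)

theorem swapUnitary_isHermitian {m n : Type*} [DecidableEq m] [Fintype n] {J V : Matrix m n ℂ} :
    (swapUnitary J V).IsHermitian := by
  simp only [swapUnitary, Matrix.IsHermitian, Matrix.conjTranspose_add, Matrix.conjTranspose_sub,
    Matrix.conjTranspose_mul, Matrix.conjTranspose_conjTranspose, Matrix.conjTranspose_one]
  abel

section

variable {m n : Type*} [Fintype m] [DecidableEq m] [Fintype n] [DecidableEq n]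
  {J V : Matrix m n ℂ}

theorem swapUnitary_mul_left (hJ : Jᴴ * J = 1) (hVJ : Vᴴ * J = 0) : swapUnitary J V * J = V := by
  simp only [swapUnitary, Matrix.mul_assoc, Matrix.add_mul, Matrix.sub_mul, hJ,
    hVJ, Matrix.mul_zero, Matrix.mul_one, Matrix.one_mul]
  abel

theorem swapUnitary_mul_right (hV : Vᴴ * V = 1) (hVJ : Vᴴ * J = 0) :
    swapUnitary J V * V = J := by
  have hJV : Jᴴ * V = 0 := by
    have := congrArg Matrix.conjTranspose hVJ
    simpa using this
  simp only [swapUnitary, Matrix.add_mul, Matrix.sub_mul, Matrix.mul_assoc, hV, hJV,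
    Matrix.mul_zero, Matrix.mul_one, Matrix.one_mul]
  abel

theorem swapUnitary_mul_self (hJ : Jᴴ * J = 1) (hV : Vᴴ * V = 1) (hVJ : Vᴴ * J = 0) :
    swapUnitary J V * swapUnitary J V = 1 := by
  conv_lhs => arg 2; rw [swapUnitary]
  rw [Matrix.mul_add, Matrix.mul_add, Matrix.mul_sub, Matrix.mul_sub, ← Matrix.mul_assoc,
    ← Matrix.mul_assoc, ← Matrix.mul_assoc, ← Matrix.mul_assoc, swapUnitary_mul_left hJ hVJ,
    swapUnitary_mul_right hV hVJ, Matrix.mul_one, swapUnitary]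
  abel

end

/-- Naimark's theorem, with a pure ancilla state. -/
theorem IsPOVM.exists_isNaimarkExtension {ι : Type*} [Fintype ι] [DecidableEq ι] {m : ℕ}
    {M : Fin m → Matrix ι ι ℂ} (hM : IsPOVM M) (hm : 0 < m) :
    ∃ (P : Fin m → Matrix (ι × Fin (m + 1)) (ι × Fin (m + 1)) ℂ)
      (σ : Matrix (Fin (m + 1)) (Fin (m + 1)) ℂ), IsNaimarkExtension M P σ := by
  let S : Fin m → Matrix ι ι ℂ := fun i => cfc Real.sqrt (M i)
  have hSH : ∀ i, (S i)ᴴ = S i := fun i => isHermitian_cfc _ _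
  have hSS : ∀ i, S i * S i = M i := fun i => cfc_sqrt_mul_self (hM.1 i)
  let J : Matrix (ι × Fin (m + 1)) ι ℂ :=
    Matrix.of fun x b => if x.2 = 0 then (1 : Matrix ι ι ℂ) x.1 b else 0
  -- `V = ∑ i, √(M i) ⊗ e_{i+1}`. The extra level `0` is left to the initial state, so `V` and `J`
  -- have orthogonal ranges and their swap is a unitary extending `V`.
  let V : Matrix (ι × Fin (m + 1)) ι ℂ :=
    Matrix.of fun x b => Fin.cases 0 (fun i => S i x.1 b) x.2
  -- Level `0` is assigned arbitrarily to the first outcome, so that the `D i` sum to the identity;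
  -- `V` never reaches it.
  obtain ⟨g, hg⟩ : ∃ g : Fin (m + 1) → Fin m, ∀ s, g s.succ = s :=
    ⟨Fin.cases ⟨0, hm⟩ id, fun _ => rfl⟩
  let D : Fin m → Matrix (ι × Fin (m + 1)) (ι × Fin (m + 1)) ℂ :=
    fun i => Matrix.diagonal fun x => if g x.2 = i then 1 else 0
  have hJ : Jᴴ * J = 1 := by
    ext a b
    simp [J, Matrix.mul_apply, Matrix.conjTranspose_apply, Fintype.sum_prod_type,
      Matrix.one_apply, eq_comm]
  have hVDV : ∀ i, Vᴴ * D i * V = M i := by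
    intro i
    ext a b
    rw [← hSS]
    conv_rhs => arg 1; rw [← hSH]
    simp [V, D, hg, Matrix.mul_apply, Matrix.conjTranspose_apply, Fintype.sum_prod_type,
      Fin.sum_univ_succ, Matrix.diagonal_apply]
  have hDsum : ∑ i, D i = 1 := by
    ext x y
    simp [D, Matrix.sum_apply, Matrix.diagonal_apply, Matrix.one_apply]
  have hV : Vᴴ * V = 1 := by
    rw [← hM.2]
    simp only [← hVDV]
    rw [← Matrix.sum_mul, ← Matrix.mul_sum, hDsum, Matrix.mul_one]
  have hVJ : Vᴴ * J = 0 := by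
    ext a b
    simp [V, J, Matrix.mul_apply, Matrix.conjTranspose_apply, Fintype.sum_prod_type]
  set U := swapUnitary J V with hU
  have hUU : U * U = 1 := swapUnitary_mul_self hJ hV hVJ
  have hUH : Uᴴ = U := swapUnitary_isHermitian
  have hUJ : U * J = V := swapUnitary_mul_left hJ hVJ
  have hDD : ∀ i, D i * D i = D i := by
    intro i
    simp [D, Matrix.diagonal_mul_diagonal]
  have hDpsd : ∀ i, (D i).PosSemidef := by
    intro i
    refine Matrix.PosSemidef.diagonal fun x => ?_
    by_cases h : g x.2 = i <;> simp [h]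
  refine ⟨fun i => U * D i * U, Matrix.single 0 0 1, ⟨⟨fun i => ?_, ?_⟩, fun i => ?_⟩, ⟨?_, ?_⟩,
    fun i => ?_⟩
  · have := (hDpsd i).mul_mul_conjTranspose_same U
    rwa [hUH] at this
  · rw [← Finset.sum_mul, ← Finset.mul_sum, hDsum, Matrix.mul_one, hUU]
  · calc U * D i * U * (U * D i * U) = U * D i * (U * U) * D i * U := by
          simp only [Matrix.mul_assoc]
      _ = U * (D i * D i) * U := by rw [hUU, Matrix.mul_one, Matrix.mul_assoc U]
      _ = _ := by rw [hDD]
  · rw [← Matrix.diagonal_single]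
    refine Matrix.PosSemidef.diagonal fun x => ?_
    by_cases h : x = 0
    · subst h; simp
    · simp [h]
  · simp
  · have h1 : Jᴴ * (U * D i * U) * J = M i := by
      have hJU : Jᴴ * U = Vᴴ := by
        rw [← hUJ, Matrix.conjTranspose_mul, hUH]
      rw [← hVDV, ← hUJ, Matrix.conjTranspose_mul, hUH]
      simp only [Matrix.mul_assoc]
    change M i = traceQ (U * D i * U * _)
    rw [← h1]
    generalize U * D i * U = X
    ext a b
    simp [J, traceQ, Matrix.mul_apply, Matrix.conjTranspose_apply, Fintype.sum_prod_type,
      Matrix.one_apply, Matrix.kroneckerMap_apply, Matrix.single_apply, ite_and,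
      apply_ite (starRingEnd ℂ)]

end Naimark

/-! ### Positivity, extremality and spectrum of SIC measurements. -/

section SIC

variable {d : ℕ} {φ : Fin (d ^ 2) → Fin d → ℂ}

theorem IsSICFrame.intrinsicRandomness_pos (hφ : IsSICFrame φ) (hd : 2 ≤ d)
    (hM : IsPOVM fun i => (1 / (d : ℂ)) • ketbra (φ i))
    {ρ : Matrix (Fin d) (Fin d) ℂ} (hρ : IsState ρ) (t : RandomnessKind) :
    0 < intrinsicRandomness t ρ fun i => (1 / (d : ℂ)) • ketbra (φ i) := by
  have hc : 0 < (1 - 1 / (d : ℝ)) / Real.log 2 := by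
    have : (1 : ℝ) < d := by exact_mod_cast hd
    refine div_pos (sub_pos.2 ?_) (Real.log_pos (by norm_num))
    rw [div_lt_one (by linarith)]
    exact this
  refine hc.trans_le ?_
  -- Without an extension the infimum would take the default value `0`.
  obtain ⟨P, σ, h⟩ := hM.exists_isNaimarkExtension (pow_pos hφ.pos 2)
  refine le_csInf ⟨_, _, P, σ, h, rfl⟩ ?_
  rintro r ⟨n, P, σ, h, rfl⟩
  exact hφ.pvmRandomness_ge h hρ t

/-- A POVM that is dominated by a multiple of a SIC measurement is equal to it. -/
theorem IsSICFrame.eq_of_posSemidef_sub (hφ : IsSICFrame φ)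
    {N : Fin (d ^ 2) → Matrix (Fin d) (Fin d) ℂ} (hN : IsPOVM N) {r : ℝ} (hr : 0 < r)
    (h : ∀ i, ((1 / (d : ℂ)) • ketbra (φ i) - (r : ℂ) • N i).PosSemidef) :
    N = fun i => (1 / (d : ℂ)) • ketbra (φ i) := by
  -- Compressing the domination by `1 - |φ i⟩⟨φ i|` kills the SIC element, so `N i` has no weight
  -- there.
  have hF : ∀ i, N i * (1 - ketbra (φ i)) = 0 := by
    intro i
    have hpsd := posSemidef_one_sub_ketbra (hφ.isUnitVec i)
    refine mul_eq_zero_of_trace_mul_eq_zero (hN.1 i) hpsd ?_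
    have hk : ketbra (φ i) * (1 - ketbra (φ i)) = 0 := by
      rw [mul_sub, mul_one, ketbra_mul_self (hφ.isUnitVec i), sub_self]
    have hFF : (1 - ketbra (φ i)) * (1 - ketbra (φ i)) = 1 - ketbra (φ i) :=
      IsIdempotentElem.one_sub (ketbra_mul_self (hφ.isUnitVec i))
    have hcyc : ∀ X : Matrix (Fin d) (Fin d) ℂ,
        ((1 - ketbra (φ i))ᴴ * X * (1 - ketbra (φ i))).trace = (X * (1 - ketbra (φ i))).trace := by
      intro X
      rw [hpsd.1, Matrix.trace_mul_comm, ← Matrix.mul_assoc, hFF, Matrix.trace_mul_comm]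
    have h1 := ((h i).conjTranspose_mul_mul_same (1 - ketbra (φ i))).trace_nonneg
    have h2 := ((hN.1 i).conjTranspose_mul_mul_same (1 - ketbra (φ i))).trace_nonneg
    rw [hcyc] at h1 h2
    rw [sub_mul, Matrix.smul_mul, Matrix.smul_mul, hk, smul_zero, zero_sub, Matrix.trace_neg,
      Matrix.trace_smul, smul_eq_mul] at h1
    have hr' : (0 : ℂ) < r := by exact_mod_cast hr
    refine le_antisymm ?_ h2
    by_contra hne
    have h3 : (r : ℂ) * (N i * (1 - ketbra (φ i))).trace = 0 :=
      le_antisymm (neg_nonneg.1 h1) (mul_nonneg hr'.le h2)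
    exact hne ((mul_eq_zero.1 h3).resolve_left hr'.ne').le
  have hR : ∀ i, N i * ketbra (φ i) = N i := fun i => by
    have := hF i
    rw [mul_sub, mul_one, sub_eq_zero] at this
    exact this.symm
  have hL : ∀ i, ketbra (φ i) * N i = N i := fun i => by
    have := congrArg Matrix.conjTranspose (hR i)
    rwa [Matrix.conjTranspose_mul, (hN.1 i).1, (ketbra_isHermitian _).eq] at this
  funext i
  exact hφ.eq_smul_ketbra (c := 1) (fun i => by rw [hL, hR]) (by rw [hN.2, one_smul]) i

theorem IsSICFrame.isExtremalPOVM (hφ : IsSICFrame φ)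
    (hM : IsPOVM fun i => (1 / (d : ℂ)) • ketbra (φ i)) :
    IsExtremalPOVM fun i => (1 / (d : ℂ)) • ketbra (φ i) := by
  refine ⟨hM, ?_⟩
  rintro N hN N' hN' ⟨a, b, ha, hb, -, hab⟩
  refine hφ.eq_of_posSemidef_sub hN ha fun i => ?_
  have h1 : (1 / (d : ℂ)) • ketbra (φ i) - (a : ℂ) • N i = (b : ℂ) • N' i := by
    rw [← congrFun hab i]
    simp
  rw [h1]
  exact (hN'.1 i).smul (Complex.zero_le_real.2 hb.le)

/-- A component of positive weight is dominated by a multiple of the SIC measurement, hence equals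
it; components of weight zero contribute nothing. -/
theorem IsSICFrame.intrinsicRandomnessCf_eq (hφ : IsSICFrame φ)
    (hM : IsPOVM fun i => (1 / (d : ℂ)) • ketbra (φ i))
    (ρ : Matrix (Fin d) (Fin d) ℂ) (t : RandomnessKind) :
    intrinsicRandomnessCf t ρ (fun i => (1 / (d : ℂ)) • ketbra (φ i)) =
      intrinsicRandomness t ρ fun i => (1 / (d : ℂ)) • ketbra (φ i) := by
  set M := fun i => (1 / (d : ℂ)) • ketbra (φ i) with hMdef
  have hset : {x : ℝ | ∃ (k : ℕ) (r : Fin k → ℝ) (N : Fin k → Fin (d ^ 2) → Matrix (Fin d) (Fin d) ℂ),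
      (∀ j, 0 ≤ r j) ∧ ∑ j, r j = 1 ∧ (∀ j, IsExtremalPOVM (N j)) ∧
      (∀ i, M i = ∑ j, (r j : ℂ) • N j i) ∧
      x = ∑ j, r j * intrinsicRandomness t ρ (N j)} = {intrinsicRandomness t ρ M} := by
    ext x
    constructor
    · rintro ⟨k, r, N, hr, hr1, hN, hdec, rfl⟩
      have h1 : ∀ j, r j * intrinsicRandomness t ρ (N j) = r j * intrinsicRandomness t ρ M := by
        intro j
        rcases (hr j).eq_or_lt with h0 | h0
        · simp [← h0]
        congr 2
        refine hφ.eq_of_posSemidef_sub (hN j).1 h0 fun i => ?_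
        have h2 : (1 / (d : ℂ)) • ketbra (φ i) - (r j : ℂ) • N j i =
            ∑ l ∈ Finset.univ.erase j, (r l : ℂ) • N l i := by
          rw [Finset.sum_erase_eq_sub (Finset.mem_univ j), ← hdec]
        rw [h2]
        exact Matrix.posSemidef_sum _ fun l _ =>
          ((hN l).1.1 i).smul (Complex.zero_le_real.2 (hr l))
      rw [Set.mem_singleton_iff, Finset.sum_congr rfl fun j _ => h1 j, ← Finset.sum_mul, hr1,
        one_mul]
    · rintro rfl
      exact ⟨1, fun _ => 1, fun _ => M, by simp, by simp, fun _ => hφ.isExtremalPOVM hM, by simp,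
        by simp⟩
  rw [intrinsicRandomnessCf, hset, csInf_singleton]

/-- A trace-one projection in dimension at least two is neither `0` nor `1`, so both values occur in
its spectrum. -/
theorem spectrum_smul_ketbra (hd : 2 ≤ d) {ψ : Fin d → ℂ} (hψ : IsUnitVec ψ) :
    spectrum ℂ ((1 / (d : ℂ)) • ketbra ψ) = {0, 1 / (d : ℂ)} := by
  have hkk := ketbra_mul_self hψ
  have hk0 : ketbra ψ ≠ 0 := fun h => by simpa [h] using trace_ketbra hψ
  have hk1 : ketbra ψ ≠ 1 := fun h => by
    have := trace_ketbra hψ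
    rw [h, Matrix.trace_one, Fintype.card_fin] at this
    have : d = 1 := by exact_mod_cast this
    omega
  have hspec : spectrum ℂ (ketbra ψ) = {0, 1} := by
    refine (IsIdempotentElem.spectrum_subset ℂ hkk).antisymm ?_
    rintro x (rfl | rfl)
    · rw [spectrum.zero_mem_iff]
      intro hu
      exact hk1 (hu.mul_left_cancel (by rw [hkk, mul_one]))
    · rw [spectrum.mem_iff, map_one]
      intro hu
      refine hk0 (hu.mul_left_cancel ?_)
      rw [sub_mul, hkk, one_mul, sub_self, mul_zero]
  have : Nonempty (Fin d) := ⟨⟨0, by omega⟩⟩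
  rw [spectrum.smul_eq_smul _ _ (by rw [hspec]; exact Set.insert_nonempty _ _), hspec,
    Set.smul_set_insert, Set.smul_set_singleton]
  simp

theorem eq_zero_of_smul_ketbra_mulVec_eq (hd : 2 ≤ d) {ψ : Fin d → ℂ} (hψ : IsUnitVec ψ)
    {v : Fin d → ℂ} (hv : ((1 / (d : ℂ)) • ketbra ψ) *ᵥ v = v) : v = 0 := by
  have hd' : (d : ℂ) ≠ 0 := Nat.cast_ne_zero.2 (by omega)
  have h1 : ketbra ψ *ᵥ v = (d : ℂ) • v := by
    conv_rhs => rw [← hv]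
    rw [Matrix.smul_mulVec, smul_smul, mul_one_div_cancel hd', one_smul]
  have h2 : (d : ℂ) • (d : ℂ) • v = (d : ℂ) • v := by
    conv_rhs => rw [← h1, ← ketbra_mul_self hψ, ← Matrix.mulVec_mulVec, h1, Matrix.mulVec_smul, h1]
  have h3 : (d : ℂ) • v = v := smul_right_injective _ hd' h2
  have h4 : ((d : ℂ) - 1) • v = 0 := by rw [sub_smul, h3, one_smul, sub_self]
  refine (smul_eq_zero.1 h4).resolve_left (sub_ne_zero.2 ?_)
  exact_mod_cast (by omega : d ≠ 1)

end SIC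

/-! ### An explicit SIC measurement on the qubit. -/

/-- The vertices of a regular tetrahedron in the Bloch sphere. -/
noncomputable def tetrahedron : Fin (2 ^ 2) → Fin 2 → ℂ :=
  -- The last three second components are `√(2/3)` times the cube roots of unity, with `√(3/4) = sin
  -- (2π/3)`.
  ![![1, 0], ![(√(1 / 3) : ℝ), (√(2 / 3) : ℝ)],
    ![(√(1 / 3) : ℝ), ⟨-√(2 / 3) / 2, √(2 / 3) * √(3 / 4)⟩],
    ![(√(1 / 3) : ℝ), ⟨-√(2 / 3) / 2, -(√(2 / 3) * √(3 / 4))⟩]]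

theorem isSIC_tetrahedron :
    IsSIC fun i => (1 / ((2 : ℕ) : ℂ)) • ketbra (tetrahedron i) := by
  have hs : √(1 / 3 : ℝ) ^ 2 = 1 / 3 := Real.sq_sqrt (by norm_num)
  have ht : √(2 / 3 : ℝ) ^ 2 = 2 / 3 := Real.sq_sqrt (by norm_num)
  have hr : √(3 / 4 : ℝ) ^ 2 = 3 / 4 := Real.sq_sqrt (by norm_num)
  unfold tetrahedron
  -- Only even powers of the roots enter, so they become symbols with known squares; fourth powers
  -- arise in the squared overlaps.
  generalize √(1 / 3 : ℝ) = s at *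
  generalize √(2 / 3 : ℝ) = t at *
  generalize √(3 / 4 : ℝ) = r at *
  have hs4 : s ^ 4 = 1 / 9 := by rw [show s ^ 4 = (s ^ 2) ^ 2 by ring, hs]; norm_num
  have ht4 : t ^ 4 = 4 / 9 := by rw [show t ^ 4 = (t ^ 2) ^ 2 by ring, ht]; norm_num
  have hr4 : r ^ 4 = 9 / 16 := by rw [show r ^ 4 = (r ^ 2) ^ 2 by ring, hr]; norm_num
  refine ⟨⟨fun i => ?_, ?_⟩, _, fun i => ?_, fun i j hij => ?_, fun i => rfl⟩
  · refine (Matrix.posSemidef_vecMulVec_self_star _).smul ?_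
    rw [one_div]
    exact inv_nonneg.2 (Nat.cast_nonneg _)
  · change ∑ i : Fin 4, _ = _
    ext a b
    rw [Matrix.sum_apply]
    fin_cases a <;> fin_cases b <;>
      simp [Fin.sum_univ_four, ketbra, Matrix.vecMulVec_apply, Complex.ext_iff] <;>
      ring_nf <;> simp only [hs, ht, hr] <;> norm_num
  · change Fin 4 at i
    fin_cases i <;> simp [IsUnitVec, dotProduct, Complex.ext_iff] <;> ring_nf <;>
      simp only [hs, ht, hr] <;> norm_num
  · change Fin 4 at i j
    rw [← Complex.normSq_eq_norm_sq]
    fin_cases i <;> fin_cases j <;> first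
      | exact absurd rfl hij
      | (simp [dotProduct, Complex.normSq_apply] <;> ring_nf <;>
          simp only [hs, ht, hr, hs4, ht4, hr4] <;> norm_num)

end QRandomness

theorem mainTheorem7 :
    (∀ (d : ℕ), 2 ≤ d → ∀ (M : Fin (d ^ 2) → Matrix (Fin d) (Fin d) ℂ), QRandomness.IsSIC M →
      (∀ i, spectrum ℂ (M i) = {0, 1 / (d : ℂ)}) ∧
      (∀ i (v : Fin d → ℂ), Matrix.mulVec (M i) v = v → v = 0) ∧
      (∀ (t : QRandomness.RandomnessKind) (ρ : Matrix (Fin d) (Fin d) ℂ), QRandomness.IsState ρ →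
        0 < QRandomness.intrinsicRandomness t ρ M ∧
        0 < QRandomness.intrinsicRandomnessCf t ρ M) ∧
      (∀ (t : QRandomness.RandomnessKind),
        ¬ (∃ ρ, QRandomness.IsNonRandom t M ρ) ∧ ¬ (∃ ρ, QRandomness.IsNonRandomCf t M ρ))) ∧
    (∃ M : Fin (2 ^ 2) → Matrix (Fin 2) (Fin 2) ℂ, QRandomness.IsSIC M) := by
  refine ⟨fun d hd M hM => ?_, _, QRandomness.isSIC_tetrahedron⟩
  obtain ⟨φ, hφ, hMφ⟩ := hM.exists_frame (by omega)
  obtain rfl : M = fun i => (1 / (d : ℂ)) • QRandomness.ketbra (φ i) := funext hMφ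
  have hpos : ∀ (t : QRandomness.RandomnessKind) (ρ : Matrix (Fin d) (Fin d) ℂ),
      QRandomness.IsState ρ →
      0 < QRandomness.intrinsicRandomness t ρ _ ∧ 0 < QRandomness.intrinsicRandomnessCf t ρ _ :=
    fun t ρ hρ => by
      rw [hφ.intrinsicRandomnessCf_eq hM.1]
      exact ⟨hφ.intrinsicRandomness_pos hd hM.1 hρ t, hφ.intrinsicRandomness_pos hd hM.1 hρ t⟩
  exact ⟨fun i => QRandomness.spectrum_smul_ketbra hd (hφ.isUnitVec i),
    fun i v hv => QRandomness.eq_zero_of_smul_ketbra_mulVec_eq hd (hφ.isUnitVec i) hv, hpos,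
    fun t => ⟨fun ⟨ρ, hρ, h0⟩ => (hpos t ρ hρ).1.ne' h0, fun ⟨ρ, hρ, h0⟩ => (hpos t ρ hρ).2.ne' h0⟩⟩
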